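/- Let $\eta_1,\eta_2>0$ with $\eta_1\neq\eta_2$, and let $U_1=\mathrm{diag}(\eta_2,\eta_1,\eta_1)$, $U_2=\mathrm{diag}(\eta_1,\eta_2,\eta_1)$, $U_3=\mathrm{diag}(\eta_1,\eta_1,\eta_2)$ and $K=\bigcup_{i=1}^3 SO(3)U_i$. A homogeneous gradient Young measure is a probability measure $\nu$ on the real $3\times3$ matrices for which there are a nonempty bounded open set $\Omega\subset\mathbb{R}^3$ and a bounded sequence $(y_n)$ in $W^{1,\infty}(\Omega;\mathbb{R}^3)$ such that, for every continuous real-valued function $f$ of $3\times 3$ matrices, $f(\nabla y_n)$ converges weakly* in $L^\infty(\Omega)$ to the constant $\int f\,d\nu$. Its barycentre is $\bar\nu=\int A\,d\nu(A)$. (i) There is no homogeneous gradient Young measure $\nu$ with $\operatorname{supp}\nu\subset K$ and $\bar\nu=\eta_1^{2/3}\eta_2^{1/3}\mathbf 1$ such that $\operatorname{supp}\nu\cap(SO(3)U_j\cup SO(3)U_k)$ contains at most two matrices for some distinct $j,k\in\{1,2,3\}$. (ii) In particular, if $\nu$ is a homogeneous gradient Young measure with $\operatorname{supp}\nu\subset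 K$ and $\bar\nu=\eta_1^{2/3}\eta_2^{1/3}\mathbf 1$, then $\operatorname{supp}\nu$ contains more than four matrices, and $\nu$ is not a double laminate, that is, $\nu$ is not of the form $(1-r)\big((1-s)\delta_A+s\delta_B\big)+r\big((1-t)\delta_C+t\delta_D\big)$ with $r,s,t\in[0,1]$ and $3\times 3$ matrices $A,B,C,D$ such that $A-B$, $C-D$ and $\big((1-s)A+sB\big)-\big((1-t)C+tD\big)$ all have rank at most one. -/

import Mathlib

open MeasureTheory Filter Topology
open scoped ContDiff

/-- The reference space `ℝ³` with its Euclidean structure. -/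
abbrev E3 : Type := EuclideanSpace ℝ (Fin 3)

/-- Real `3 × 3` matrices. -/
abbrev M33 : Type := Matrix (Fin 3) (Fin 3) ℝ

/-- Measures on `3 × 3` matrices are Borel measures. -/
instance M33.measurableSpace : MeasurableSpace M33 := borel M33

instance M33.borelSpace : BorelSpace M33 := ⟨rfl⟩

/-! ### Tetragonal wells -/

/-- `U₁ = diag(η₂, η₁, η₁)`, `U₂ = diag(η₁, η₂, η₁)`, `U₃ = diag(η₁, η₁, η₂)`. -/
def tetragonalU (η₁ η₂ : ℝ) (i : Fin 3) : M33 :=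
  Matrix.diagonal fun j => if j = i then η₂ else η₁

/-- The energy well `SO(3) Uᵢ`. -/
def tetragonalWell (η₁ η₂ : ℝ) (i : Fin 3) : Set M33 :=
  {A | ∃ R ∈ Matrix.specialOrthogonalGroup (Fin 3) ℝ, A = R * tetragonalU η₁ η₂ i}

/-- `K = SO(3) U₁ ∪ SO(3) U₂ ∪ SO(3) U₃`. -/
def tetragonalK (η₁ η₂ : ℝ) : Set M33 :=
  ⋃ i, tetragonalWell η₁ η₂ i

/-! ### Gradient Young measures -/

/-- `G` is the weak gradient of `y` on `Ω`: `G i j = ∂ yᵢ / ∂ xⱼ` in the sense of distributions. -/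
def HasWeakGradient (Ω : Set E3) (y : E3 → E3) (G : E3 → M33) : Prop :=
  ∀ (i j : Fin 3) (φ : E3 → ℝ), ContDiff ℝ ∞ φ → HasCompactSupport φ → tsupport φ ⊆ Ω →
    ∫ x in Ω, y x i * fderiv ℝ φ x (EuclideanSpace.single j 1) = -∫ x in Ω, G x i j * φ x

/-- The maps `y n`, with weak gradients `G n`, form a bounded sequence in `W^{1,∞}(Ω; ℝ³)`. -/
structure IsBoundedW1Inf (Ω : Set E3) (y : ℕ → E3 → E3) (G : ℕ → E3 → M33) : Prop where
  aestronglyMeasurable : ∀ n, AEStronglyMeasurable (y n) (volume.restrict Ω)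
  aestronglyMeasurable_grad : ∀ n, AEStronglyMeasurable (G n) (volume.restrict Ω)
  hasWeakGradient : ∀ n, HasWeakGradient Ω (y n) (G n)
  bounded : ∃ M : ℝ, ∀ n, ∀ᵐ x ∂(volume.restrict Ω), ‖y n x‖ ≤ M ∧ ∀ i j, |G n x i j| ≤ M

/-- `ν` is a homogeneous gradient Young measure: a probability measure such that, on some nonempty
bounded open set `Ω`, the constant family `ν_x = ν` is the Young measure of the gradients of a
bounded sequence in `W^{1,∞}(Ω; ℝ³)`, that is, `f(∇yₙ)` converges to `⟨ν, f⟩` weakly* in `L^∞(Ω)`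
for every continuous `f`. -/
def IsHomogeneousGradientYoungMeasure (ν : Measure M33) : Prop :=
  IsProbabilityMeasure ν ∧
    ∃ Ω : Set E3, IsOpen Ω ∧ Bornology.IsBounded Ω ∧ Ω.Nonempty ∧
      ∃ (y : ℕ → E3 → E3) (G : ℕ → E3 → M33), IsBoundedW1Inf Ω y G ∧
        ∀ f : M33 → ℝ, Continuous f → ∀ φ : E3 → ℝ, IntegrableOn φ Ω →
          Tendsto (fun n => ∫ x in Ω, φ x * f (G n x)) atTop
            (𝓝 ((∫ x in Ω, φ x) * ∫ A, f A ∂ν))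

/-- The barycentre `∫ A dν(A)`, computed entrywise. -/
noncomputable def barycentre (ν : Measure M33) : M33 :=
  Matrix.of fun i j => ∫ A, A i j ∂ν

/-- Double (second-order) laminates: mixtures of two simple laminates
`(1 - s) δ_A + s δ_B` and `(1 - t) δ_C + t δ_D` with volume fractions `1 - r` and `r`, where
`A, B` are rank-one connected, `C, D` are rank-one connected and the two averages are rank-one
connected. Degenerate cases (coinciding matrices, vanishing volume fractions) are allowed. -/
def IsDoubleLaminate (ν : Measure M33) : Prop :=
  ∃ (A B C D : M33) (r s t : ℝ), r ∈ Set.Icc 0 1 ∧ s ∈ Set.Icc 0 1 ∧ t ∈ Set.Icc 0 1 ∧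
    (A - B).rank ≤ 1 ∧ (C - D).rank ≤ 1 ∧
    (((1 - s) • A + s • B) - ((1 - t) • C + t • D)).rank ≤ 1 ∧
    ν = ENNReal.ofReal (1 - r) •
          (ENNReal.ofReal (1 - s) • Measure.dirac A + ENNReal.ofReal s • Measure.dirac B) +
        ENNReal.ofReal r •
          (ENNReal.ofReal (1 - t) • Measure.dirac C + ENNReal.ofReal t • Measure.dirac D)

/-! Write d for the scale of the barycentre, so d³ = η₁²η₂. Weak* continuity of 2 × 2 minors of
gradients gives the minors relation: the ν-average of the cofactor matrix is the cofactor matrix of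
the barycentre, here d²·1 (`IsHomogeneousGradientYoungMeasure.integral_minor`).

For A = R Uᵢ both A and cof A = R cof Uᵢ are R times a diagonal matrix, and η₂A − cof A annihilates
every column except the i-th, where it gives (η₂² − η₁²) R eᵢ. Averaging this combination isolates
each well: the integral of R eⱼ over well j is β eⱼ with β = (η₂d − d²)/(η₂² − η₁²) > 0, and the
integral of Rᵢᵢ over the two wells other than i is an explicit number ξ. The decisive inequality is
2β < ξ (`well_fraction_inequalities`).

Since β > 0, every well meets the support. If wells j and k together carry at most two support
matrices, each carries exactly one, whose rotation must then fix eⱼ, respectively eₖ; so both wells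
have mass β. With i the third index, Rᵢᵢ ≤ 1 yields ξ ≤ 2β, a contradiction. Hence any two wells
contain at least three support matrices, which forces at least five in all, whereas a double
laminate has at most four. -/

/-! ### Weak derivatives and integration by parts of minors -/

/-- `g` is the weak derivative of `u` on `Ω` in the direction `v`. -/
def HasWeakDeriv (Ω : Set E3) (v : E3) (u g : E3 → ℝ) : Prop :=
  ∀ φ : E3 → ℝ, ContDiff ℝ ∞ φ → HasCompactSupport φ → tsupport φ ⊆ Ω →
    ∫ x in Ω, u x * fderiv ℝ φ x v = -∫ x in Ω, g x * φ x

/-- `u` is a measurable function on `Ω` that is a.e. bounded by `M`. -/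
structure IsBddOn (Ω : Set E3) (M : ℝ) (u : E3 → ℝ) : Prop where
  aesm : AEStronglyMeasurable u (volume.restrict Ω)
  bound : ∀ᵐ x ∂(volume.restrict Ω), |u x| ≤ M

namespace IsBddOn

variable {Ω : Set E3} {M : ℝ} {u : E3 → ℝ}

theorem integrable_mul (hu : IsBddOn Ω M u) {w : E3 → ℝ} (hw : IntegrableOn w Ω) :
    IntegrableOn (fun x => u x * w x) Ω :=
  Integrable.bdd_mul hw hu.aesm hu.bound

theorem integrableOn (hu : IsBddOn Ω M u) (hΩ : Bornology.IsBounded Ω) : IntegrableOn u Ω := by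
  have : IsFiniteMeasure (volume.restrict Ω) := ⟨by simpa using hΩ.measure_lt_top⟩
  simpa using hu.integrable_mul (integrable_const (1 : ℝ))

theorem indicator_integrable (hu : IsBddOn Ω M u) (hΩ : Bornology.IsBounded Ω)
    (hΩo : IsOpen Ω) : Integrable (Ω.indicator u) :=
  (integrable_indicator_iff hΩo.measurableSet).2 (hu.integrableOn hΩ)

theorem norm_integral_mul_le (hu : IsBddOn Ω M u) {w : E3 → ℝ} (hw : IntegrableOn w Ω) :
    |∫ x in Ω, u x * w x| ≤ M * ∫ x in Ω, |w x| := by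
  rw [← integral_const_mul, ← Real.norm_eq_abs]
  refine norm_integral_le_of_norm_le (hw.norm.const_mul M) ?_
  filter_upwards [hu.bound] with x hx
  rw [norm_mul]
  exact mul_le_mul_of_nonneg_right hx (norm_nonneg _)

end IsBddOn

theorem contDiff_fderiv_apply_const {φ : E3 → ℝ} (hφ : ContDiff ℝ ∞ φ) (v : E3) :
    ContDiff ℝ ∞ (fun x => fderiv ℝ φ x v) :=
  (hφ.fderiv_right (m := ∞) (by simp)).clm_apply contDiff_const

/-- Mixed weak derivatives commute. -/
theorem HasWeakDeriv.integral_mul_fderiv_comm {Ω : Set E3} {a b : E3} {v ga gb : E3 → ℝ}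
    (ha : HasWeakDeriv Ω a v ga) (hb : HasWeakDeriv Ω b v gb) {ψ : E3 → ℝ}
    (hψ : ContDiff ℝ ∞ ψ) (hc : HasCompactSupport ψ) (hs : tsupport ψ ⊆ Ω) :
    ∫ x in Ω, gb x * fderiv ℝ ψ x a = ∫ x in Ω, ga x * fderiv ℝ ψ x b := by
  have h1 := hb _ (contDiff_fderiv_apply_const hψ a) (hc.fderiv_apply ℝ a)
    ((tsupport_fderiv_apply_subset ℝ a).trans hs)
  have h2 := ha _ (contDiff_fderiv_apply_const hψ b) (hc.fderiv_apply ℝ b)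
    ((tsupport_fderiv_apply_subset ℝ b).trans hs)
  have h3 : ∀ x, fderiv ℝ (fun x => fderiv ℝ ψ x a) x b = fderiv ℝ (fun x => fderiv ℝ ψ x b) x a := by
    intro x
    have hd : DifferentiableAt ℝ (fderiv ℝ ψ) x :=
      (hψ.fderiv_right (m := 1) (by norm_cast)).differentiable one_ne_zero x
    have hsymm : IsSymmSndFDerivAt ℝ ψ x :=
      (hψ.contDiffAt).isSymmSndFDerivAt (by simp; norm_cast)
    rw [fderiv_clm_apply hd (differentiableAt_const _), fderiv_clm_apply hd (differentiableAt_const _)]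
    simpa using hsymm.eq b a
  simp only [h3] at h1
  linarith

/-- Integration by parts of a `2 × 2` minor, one of the two functions being smooth. -/
theorem HasWeakDeriv.integral_minor_of_contDiff {Ω : Set E3}
    {a b : E3} {v ga gb w φ : E3 → ℝ} {M : ℝ}
    (ha : HasWeakDeriv Ω a v ga) (hb : HasWeakDeriv Ω b v gb)
    (hga : IsBddOn Ω M ga) (hgb : IsBddOn Ω M gb) (hw : ContDiff ℝ ∞ w)
    (hφ : ContDiff ℝ ∞ φ) (hc : HasCompactSupport φ) (hs : tsupport φ ⊆ Ω) :
    ∫ x in Ω, φ x * (fderiv ℝ w x a * gb x - fderiv ℝ w x b * ga x) =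
      -∫ x in Ω, w x * (fderiv ℝ φ x a * gb x - fderiv ℝ φ x b * ga x) := by
  -- Testing the symmetry of mixed derivatives with φw, the product rule splits the identity into
  -- the two sides of the claim.
  have h := ha.integral_mul_fderiv_comm hb (hφ.mul hw) hc.mul_right
    ((tsupport_mul_subset_left).trans hs)
  have hd : ∀ x c, fderiv ℝ (fun x => φ x * w x) x c =
      φ x * fderiv ℝ w x c + w x * fderiv ℝ φ x c := by
    intro x c
    rw [fderiv_fun_mul (hφ.differentiable (by simp) x) (hw.differentiable (by simp) x)]
    simp
  have hi : ∀ (f : E3 → ℝ), Continuous f → HasCompactSupport f → IntegrableOn f Ω :=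
    fun f hf hc => (hf.integrable_of_hasCompactSupport hc).integrableOn
  have hI1 : ∀ c, IntegrableOn (fun x => φ x * fderiv ℝ w x c) Ω := fun c =>
    hi _ (hφ.continuous.mul (contDiff_fderiv_apply_const hw c).continuous) hc.mul_right
  have hI2 : ∀ c, IntegrableOn (fun x => w x * fderiv ℝ φ x c) Ω := fun c =>
    hi _ (hw.continuous.mul (contDiff_fderiv_apply_const hφ c).continuous)
      (hc.fderiv_apply ℝ c).mul_left
  simp only [hd] at h
  rw [← sub_eq_zero, sub_neg_eq_add, ← integral_add]
  · rw [← sub_eq_zero, ← integral_sub] at h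
    · rw [← h]
      congr 1
      ext x
      ring
    · exact hgb.integrable_mul ((hI1 a).add (hI2 a))
    · exact hga.integrable_mul ((hI1 b).add (hI2 b))
  · refine ((hgb.integrable_mul (hI1 a)).sub (hga.integrable_mul (hI1 b))).congr (ae_of_all _ fun x => ?_)
    simp only [Pi.sub_apply]
    ring
  · refine ((hgb.integrable_mul (hI2 a)).sub (hga.integrable_mul (hI2 b))).congr (ae_of_all _ fun x => ?_)
    simp only [Pi.sub_apply]
    ring

/-! ### Mollification -/

/-- The mollification of `u`, extended by zero outside `Ω`. -/
noncomputable def mollify (ρ : ContDiffBump (0 : E3)) (Ω : Set E3) (u : E3 → ℝ) (x : E3) : ℝ :=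
  ∫ t in Ω, u t * ρ.normed volume (x - t)

open scoped Convolution in
theorem mollify_eq_convolution (ρ : ContDiffBump (0 : E3)) {Ω : Set E3} (hΩ : IsOpen Ω)
    (u : E3 → ℝ) :
    mollify ρ Ω u = Ω.indicator u ⋆[ContinuousLinearMap.mul ℝ ℝ, volume] ρ.normed volume := by
  ext x
  rw [mollify, ← integral_indicator hΩ.measurableSet, convolution_def]
  congr 1
  ext t
  by_cases ht : t ∈ Ω <;> simp [ht]

-- The order of factors, kernel first, in which the a.e. convergence theorem for bump convolutions
-- applies.
open scoped Convolution in
theorem mollify_eq_convolution_swap (ρ : ContDiffBump (0 : E3)) {Ω : Set E3} (hΩ : IsOpen Ω)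
    (u : E3 → ℝ) :
    mollify ρ Ω u = ρ.normed volume ⋆[ContinuousLinearMap.lsmul ℝ ℝ, volume] Ω.indicator u := by
  ext x
  rw [mollify_eq_convolution ρ hΩ, convolution_lsmul_swap, convolution_def]
  congr 1
  ext t
  simp [mul_comm]

section

variable {Ω : Set E3} {M : ℝ} {u g : E3 → ℝ} {v : E3}

theorem contDiff_mollify (ρ : ContDiffBump (0 : E3)) (hΩ : IsOpen Ω) (hb : Bornology.IsBounded Ω)
    (hu : IsBddOn Ω M u) : ContDiff ℝ ∞ (mollify ρ Ω u) := by
  rw [mollify_eq_convolution ρ hΩ]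
  exact ρ.hasCompactSupport_normed.contDiff_convolution_right (n := ⊤) _
    (hu.indicator_integrable hb hΩ).locallyIntegrable ρ.contDiff_normed

theorem fderiv_mollify (ρ : ContDiffBump (0 : E3)) (hΩ : IsOpen Ω) (hb : Bornology.IsBounded Ω)
    (hu : IsBddOn Ω M u) (x v : E3) :
    fderiv ℝ (mollify ρ Ω u) x v = ∫ t in Ω, u t * fderiv ℝ (ρ.normed volume) (x - t) v := by
  have hli := (hu.indicator_integrable hb hΩ).locallyIntegrable
  rw [mollify_eq_convolution ρ hΩ,
    (ρ.hasCompactSupport_normed.hasFDerivAt_convolution_right _ hli ρ.contDiff_normed x).fderiv,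
    convolution_precompR_apply _ hli (ρ.hasCompactSupport_normed.fderiv ℝ)
      (ρ.contDiff_normed (n := 1).continuous_fderiv one_ne_zero),
    ← integral_indicator hΩ.measurableSet, convolution_def]
  congr 1
  ext t
  by_cases ht : t ∈ Ω <;> simp [ht]

/-- The kernel t ↦ ρ(x − t) is an admissible test function once its support stays inside Ω; the sign
from differentiating x − t cancels the one in the weak derivative. -/
theorem HasWeakDeriv.fderiv_mollify (h : HasWeakDeriv Ω v u g) (ρ : ContDiffBump (0 : E3))
    (hΩ : IsOpen Ω) (hb : Bornology.IsBounded Ω) (hu : IsBddOn Ω M u) {x : E3}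
    (hx : Metric.closedBall x ρ.rOut ⊆ Ω) :
    fderiv ℝ (mollify ρ Ω u) x v = mollify ρ Ω g x := by
  have hcd : ContDiff ℝ ∞ (ρ.normed (volume : Measure E3)) := ρ.contDiff_normed (n := ⊤)
  have hsub : ContDiff ℝ ∞ (fun t : E3 => x - t) := contDiff_const.sub contDiff_id
  have hts : tsupport (fun t => ρ.normed (volume : Measure E3) (x - t)) ⊆
      Metric.closedBall x ρ.rOut := by
    refine closure_minimal (fun t ht => ?_) Metric.isClosed_closedBall
    have : x - t ∈ Function.support (ρ.normed (volume : Measure E3)) := ht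
    rw [ρ.support_normed_eq] at this
    rw [Metric.mem_closedBall, dist_comm, dist_eq_norm]
    simpa using (Metric.mem_ball.1 this).le
  have key := h (fun t => ρ.normed volume (x - t)) (hcd.comp hsub)
    ((isCompact_closedBall x ρ.rOut).of_isClosed_subset (isClosed_tsupport _) hts) (hts.trans hx)
  have hd : ∀ t, fderiv ℝ (fun t => ρ.normed (volume : Measure E3) (x - t)) t v =
      -fderiv ℝ (ρ.normed volume) (x - t) v := by
    intro t
    have h1 := ((hcd.differentiable (by simp) (x - t)).hasFDerivAt).comp t
      ((hasFDerivAt_id t).const_sub x)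
    have h2 : fderiv ℝ (fun t => ρ.normed (volume : Measure E3) (x - t)) t = _ := h1.fderiv
    rw [h2]
    simp
  rw [_root_.fderiv_mollify ρ hΩ hb hu, mollify]
  simp only [hd, mul_neg, integral_neg, neg_inj] at key
  exact key

theorem integral_normed_sub (ρ : ContDiffBump (0 : E3)) (x : E3) :
    ∫ t, ρ.normed volume (x - t) = 1 := by
  rw [integral_sub_left_eq_self, ρ.integral_normed]

theorem integrable_normed_sub (ρ : ContDiffBump (0 : E3)) (x : E3) :
    Integrable (fun t => ρ.normed volume (x - t)) :=
  ρ.integrable_normed.comp_sub_left x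

theorem normed_sub_eq_zero (ρ : ContDiffBump (0 : E3)) {x t : E3} (h : ρ.rOut ≤ dist x t) :
    ρ.normed volume (x - t) = 0 := by
  by_contra h0
  have : x - t ∈ Function.support (ρ.normed (volume : Measure E3)) := h0
  rw [ρ.support_normed_eq, Metric.mem_ball, dist_zero_right, ← dist_eq_norm] at this
  linarith

theorem setIntegral_normed_sub (ρ : ContDiffBump (0 : E3)) {x : E3}
    (hx : Metric.closedBall x ρ.rOut ⊆ Ω) : ∫ t in Ω, ρ.normed volume (x - t) = 1 := by
  rw [setIntegral_eq_integral_of_forall_compl_eq_zero, integral_normed_sub]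
  intro t ht
  refine normed_sub_eq_zero ρ ?_
  by_contra! h
  exact ht (hx (by rw [Metric.mem_closedBall, dist_comm]; exact h.le))

theorem abs_mollify_le (ρ : ContDiffBump (0 : E3)) (hu : IsBddOn Ω M u) (hM : 0 ≤ M) (x : E3) :
    |mollify ρ Ω u x| ≤ M := by
  refine (hu.norm_integral_mul_le (integrable_normed_sub ρ x).integrableOn).trans ?_
  refine mul_le_of_le_one_right hM ?_
  simp only [abs_of_nonneg (ρ.nonneg_normed _)]
  rw [← integral_normed_sub ρ x]
  exact setIntegral_le_integral (integrable_normed_sub ρ x)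
    (ae_of_all _ fun t => ρ.nonneg_normed _)

/-- A bump function with outer radius `s`. -/
noncomputable def bumpOfRadius {s : ℝ} (hs : 0 < s) : ContDiffBump (0 : E3) :=
  ⟨s / 2, s, by linarith, by linarith⟩

theorem ae_tendsto_mollify (hΩ : IsOpen Ω) (hb : Bornology.IsBounded Ω) (hu : IsBddOn Ω M u)
    {s : ℕ → ℝ} (hs : ∀ k, 0 < s k) (hs0 : Tendsto s atTop (𝓝 0)) :
    ∀ᵐ x ∂(volume.restrict Ω),
      Tendsto (fun k => mollify (bumpOfRadius (hs k)) Ω u x) atTop (𝓝 (u x)) := by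
  have := ContDiffBump.ae_convolution_tendsto_right_of_locallyIntegrable (μ := volume)
    (φ := fun k => bumpOfRadius (hs k)) (l := atTop) (K := 2) (g := Ω.indicator u)
    hs0 (Eventually.of_forall fun k => by simp [bumpOfRadius]; linarith)
    (hu.indicator_integrable hb hΩ).locallyIntegrable
  filter_upwards [ae_restrict_of_ae this, ae_restrict_mem hΩ.measurableSet] with x hx hxΩ
  simpa only [mollify_eq_convolution_swap _ hΩ, Set.indicator_of_mem hxΩ] using hx

end

/-! ### Uniform approximation by mollification, and minors of weak gradients -/

theorem norm_le_of_forall_single {f : E3 →L[ℝ] ℝ} {M : ℝ}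
    (h : ∀ j, |f (EuclideanSpace.single j 1)| ≤ M) : ‖f‖ ≤ 3 * M := by
  have hM : 0 ≤ M := (abs_nonneg _).trans (h 0)
  refine f.opNorm_le_bound (by positivity) fun z => ?_
  have hz : z = ∑ j, z j • EuclideanSpace.single j (1 : ℝ) := by
    ext i
    simp [Finset.sum_apply, Pi.single_apply]
  have hf : f z = ∑ j, z j * f (EuclideanSpace.single j 1) := by
    conv_lhs => rw [hz]
    simp
  rw [hf]
  calc ‖∑ j, z j * f (EuclideanSpace.single j 1)‖ ≤ ∑ j : Fin 3, ‖z‖ * M := by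
        refine norm_sum_le_of_le _ fun j _ => ?_
        rw [norm_mul]
        exact mul_le_mul (PiLp.norm_apply_le z j) (h j) (norm_nonneg _) (norm_nonneg _)
    _ = 3 * M * ‖z‖ := by simp; ring

section

variable {Ω : Set E3} {M : ℝ} {u : E3 → ℝ} {p : Fin 3 → E3 → ℝ} {x₀ : E3} {r : ℝ}

/-- Mean value inequality on a convex ball, where the gradient of the mollification is the mollified
gradient. The radius 3r leaves room for a kernel of radius below r around each point of the ball of
radius 2r. -/
theorem HasWeakDeriv.abs_mollify_sub_mollify_le
    (h : ∀ j, HasWeakDeriv Ω (EuclideanSpace.single j 1) u (p j))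
    (hΩ : IsOpen Ω) (hb : Bornology.IsBounded Ω) (hu : IsBddOn Ω M u)
    (hp : ∀ j, IsBddOn Ω M (p j)) (hM : 0 ≤ M) (hB : Metric.closedBall x₀ (3 * r) ⊆ Ω)
    (ρ : ContDiffBump (0 : E3)) (hρ : ρ.rOut < r) {x t : E3}
    (hx : x ∈ Metric.ball x₀ (2 * r)) (ht : t ∈ Metric.ball x₀ (2 * r)) :
    |mollify ρ Ω u t - mollify ρ Ω u x| ≤ 3 * M * dist t x := by
  rw [dist_eq_norm]
  refine Convex.norm_image_sub_le_of_norm_fderiv_le (𝕜 := ℝ)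
    (fun y _ => (contDiff_mollify ρ hΩ hb hu).differentiable (by simp) y) (fun y hy => ?_)
    (convex_ball x₀ (2 * r)) hx ht
  refine norm_le_of_forall_single fun j => ?_
  rw [(h j).fderiv_mollify ρ hΩ hb hu]
  · exact abs_mollify_le ρ (hp j) hM y
  · refine (Metric.closedBall_subset_closedBall' ?_).trans hB
    linarith [Metric.mem_ball.1 hy]

/-- A function with bounded weak gradient is close to its mollifications. -/
theorem HasWeakDeriv.ae_abs_mollify_sub_le
    (h : ∀ j, HasWeakDeriv Ω (EuclideanSpace.single j 1) u (p j))
    (hΩ : IsOpen Ω) (hb : Bornology.IsBounded Ω) (hu : IsBddOn Ω M u)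
    (hp : ∀ j, IsBddOn Ω M (p j)) (hM : 0 ≤ M) (hB : Metric.closedBall x₀ (3 * r) ⊆ Ω)
    (hr : 0 < r) (ρ : ContDiffBump (0 : E3)) (hρ : ρ.rOut < r) :
    ∀ᵐ x ∂(volume.restrict Ω), x ∈ Metric.ball x₀ r →
      |u x - mollify ρ Ω u x| ≤ 3 * M * ρ.rOut := by
  have hs : ∀ k : ℕ, 0 < r * (1 / 2) ^ (k + 1) := fun k => by positivity
  have hs0 : Tendsto (fun k : ℕ => r * (1 / 2 : ℝ) ^ (k + 1)) atTop (𝓝 0) := by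
    simpa using ((tendsto_pow_atTop_nhds_zero_of_lt_one (by norm_num : (0 : ℝ) ≤ 1 / 2)
      (by norm_num)).comp (tendsto_add_atTop_nat 1)).const_mul r
  have hlt : ∀ k : ℕ, r * (1 / 2 : ℝ) ^ (k + 1) < r := fun k =>
    mul_lt_of_lt_one_right hr (pow_lt_one₀ (by norm_num) (by norm_num) (by simp))
  have hae := ae_tendsto_mollify hΩ hb hu hs hs0
  filter_upwards [hae] with x hx hxr
  have hx2 : x ∈ Metric.ball x₀ (2 * r) := Metric.ball_subset_ball (by linarith) hxr
  have hcb : Metric.closedBall x ρ.rOut ⊆ Ω := by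
    refine (Metric.closedBall_subset_closedBall' ?_).trans hB
    linarith [Metric.mem_ball.1 hxr]
  have hInt : IntegrableOn (fun t => ρ.normed volume (x - t)) Ω :=
    (integrable_normed_sub ρ x).integrableOn
  have heq : u x - mollify ρ Ω u x = ∫ t in Ω, (u x - u t) * ρ.normed volume (x - t) := by
    simp only [sub_mul]
    rw [integral_sub (hInt.const_mul _) (hu.integrable_mul hInt), integral_const_mul,
      setIntegral_normed_sub ρ hcb, mul_one, mollify]
  rw [heq, ← mul_one (3 * M * ρ.rOut), ← setIntegral_normed_sub ρ hcb, ← integral_const_mul]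
  rw [← Real.norm_eq_abs]
  refine norm_integral_le_of_norm_le (hInt.const_mul _) ?_
  filter_upwards [hae] with t ht
  rw [norm_mul, Real.norm_of_nonneg (ρ.nonneg_normed _)]
  rcases le_or_gt ρ.rOut (dist x t) with hd | hd
  · simp [normed_sub_eq_zero ρ hd]
  · refine mul_le_mul_of_nonneg_right ?_ (ρ.nonneg_normed _)
    have ht2 : t ∈ Metric.ball x₀ (2 * r) := by
      rw [Metric.mem_ball] at hxr ⊢
      linarith [dist_triangle t x x₀, dist_comm x t]
    refine le_trans ?_ (mul_le_mul_of_nonneg_left hd.le (by positivity))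
    -- The Lipschitz bound for `u` itself, at almost every pair of points, is the limit of the
    -- bounds for ever finer mollifications.
    refine le_of_tendsto (hx.sub ht).norm (Eventually.of_forall fun k => ?_)
    exact HasWeakDeriv.abs_mollify_sub_mollify_le h hΩ hb hu hp hM hB _ (hlt k) ht2 hx2

theorem IsBddOn.tendsto_integral_mollify (hΩ : IsOpen Ω) (hb : Bornology.IsBounded Ω)
    (hM : 0 ≤ M) (hu : IsBddOn Ω M u) {w : E3 → ℝ} (hw : IntegrableOn w Ω)
    {s : ℕ → ℝ} (hs : ∀ k, 0 < s k) (hs0 : Tendsto s atTop (𝓝 0)) :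
    Tendsto (fun k => ∫ x in Ω, mollify (bumpOfRadius (hs k)) Ω u x * w x) atTop
      (𝓝 (∫ x in Ω, u x * w x)) := by
  refine tendsto_integral_of_dominated_convergence (fun x => M * ‖w x‖) (fun k => ?_)
    (hw.norm.const_mul M) (fun k => ae_of_all _ fun x => ?_) ?_
  · exact (contDiff_mollify _ hΩ hb hu).continuous.aestronglyMeasurable.mul
      hw.aestronglyMeasurable
  · rw [norm_mul]
    exact mul_le_mul_of_nonneg_right (abs_mollify_le _ hu hM x) (norm_nonneg _)
  · filter_upwards [ae_tendsto_mollify hΩ hb hu hs hs0] with x hx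
    exact hx.mul_const _

theorem IsBddOn.mollify (hu : IsBddOn Ω M u) (hΩ : IsOpen Ω) (hb : Bornology.IsBounded Ω)
    (hM : 0 ≤ M) (ρ : ContDiffBump (0 : E3)) : IsBddOn Ω M (mollify ρ Ω u) :=
  ⟨(contDiff_mollify _ hΩ hb hu).continuous.aestronglyMeasurable,
    ae_of_all _ fun x => abs_mollify_le _ hu hM x⟩

/-- The `2 × 2` minor of the gradients of a mollified function and of `v`, tested with `φ`. -/
theorem HasWeakDeriv.integral_minor_mollify {a b : E3} {pa pb v ga gb φ : E3 → ℝ}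
    (hpa : HasWeakDeriv Ω a u pa) (hpb : HasWeakDeriv Ω b u pb)
    (ha : HasWeakDeriv Ω a v ga) (hb' : HasWeakDeriv Ω b v gb)
    (hΩ : IsOpen Ω) (hb : Bornology.IsBounded Ω) (hu : IsBddOn Ω M u)
    (hga : IsBddOn Ω M ga) (hgb : IsBddOn Ω M gb)
    (hφ : ContDiff ℝ ∞ φ) (hc : HasCompactSupport φ) (hs : tsupport φ ⊆ Ω)
    (ρ : ContDiffBump (0 : E3)) (hρ : ∀ x ∈ tsupport φ, Metric.closedBall x ρ.rOut ⊆ Ω) :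
    ∫ x in Ω, φ x * (mollify ρ Ω pa x * gb x - mollify ρ Ω pb x * ga x) =
      -∫ x in Ω, mollify ρ Ω u x * (fderiv ℝ φ x a * gb x - fderiv ℝ φ x b * ga x) := by
  rw [← ha.integral_minor_of_contDiff hb' hga hgb (contDiff_mollify ρ hΩ hb hu) hφ hc hs]
  congr 1
  ext x
  by_cases hx : x ∈ tsupport φ
  · rw [hpa.fderiv_mollify ρ hΩ hb hu (hρ x hx), hpb.fderiv_mollify ρ hΩ hb hu (hρ x hx)]
  · simp [image_eq_zero_of_notMem_tsupport hx]

/-- Integration by parts of a `2 × 2` minor of a weak gradient. -/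
theorem HasWeakDeriv.integral_minor {a b : E3} {pa pb v ga gb φ : E3 → ℝ}
    (hpa : HasWeakDeriv Ω a u pa) (hpb : HasWeakDeriv Ω b u pb)
    (ha : HasWeakDeriv Ω a v ga) (hb' : HasWeakDeriv Ω b v gb)
    (hΩ : IsOpen Ω) (hb : Bornology.IsBounded Ω) (hM : 0 ≤ M) (hu : IsBddOn Ω M u)
    (hpab : IsBddOn Ω M pa) (hpbb : IsBddOn Ω M pb)
    (hga : IsBddOn Ω M ga) (hgb : IsBddOn Ω M gb)
    (hφ : ContDiff ℝ ∞ φ) (hc : HasCompactSupport φ) (hr : 0 < r)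
    (hρ : ∀ x ∈ tsupport φ, Metric.closedBall x r ⊆ Ω) :
    ∫ x in Ω, φ x * (pa x * gb x - pb x * ga x) =
      -∫ x in Ω, u x * (fderiv ℝ φ x a * gb x - fderiv ℝ φ x b * ga x) := by
  have hs : ∀ k : ℕ, 0 < r * (1 / 2) ^ (k + 1) := fun k => by positivity
  have hs0 : Tendsto (fun k : ℕ => r * (1 / 2 : ℝ) ^ (k + 1)) atTop (𝓝 0) := by
    simpa using ((tendsto_pow_atTop_nhds_zero_of_lt_one (by norm_num : (0 : ℝ) ≤ 1 / 2)
      (by norm_num)).comp (tendsto_add_atTop_nat 1)).const_mul r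
  have hlt : ∀ k : ℕ, r * (1 / 2 : ℝ) ^ (k + 1) < r := fun k =>
    mul_lt_of_lt_one_right hr (pow_lt_one₀ (by norm_num) (by norm_num) (by simp))
  have hφi : IntegrableOn φ Ω := (hφ.continuous.integrable_of_hasCompactSupport hc).integrableOn
  have hdi : ∀ c, IntegrableOn (fun x => fderiv ℝ φ x c) Ω := fun c =>
    ((contDiff_fderiv_apply_const hφ c).continuous.integrable_of_hasCompactSupport
      (hc.fderiv_apply ℝ c)).integrableOn
  have hsplit : ∀ {P Q : E3 → ℝ}, IsBddOn Ω M P → IsBddOn Ω M Q →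
      ∫ x in Ω, φ x * (P x * gb x - Q x * ga x) =
        (∫ x in Ω, P x * (gb x * φ x)) - ∫ x in Ω, Q x * (ga x * φ x) := by
    intro P Q hP hQ
    rw [← integral_sub (hP.integrable_mul (hgb.integrable_mul hφi))
      (hQ.integrable_mul (hga.integrable_mul hφi))]
    congr 1
    ext x
    ring
  have hdint : IntegrableOn (fun x => fderiv ℝ φ x a * gb x - fderiv ℝ φ x b * ga x) Ω := by
    refine ((hgb.integrable_mul (hdi a)).sub (hga.integrable_mul (hdi b))).congr
      (ae_of_all _ fun x => ?_)
    simp only [Pi.sub_apply]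
    ring
  have hR := (IsBddOn.tendsto_integral_mollify hΩ hb hM hu hdint hs hs0).neg
  have hL := (IsBddOn.tendsto_integral_mollify hΩ hb hM hpab
    (hgb.integrable_mul hφi) hs hs0).sub (IsBddOn.tendsto_integral_mollify hΩ hb hM hpbb
    (hga.integrable_mul hφi) hs hs0)
  rw [hsplit hpab hpbb]
  -- The identity holds for each mollified first factor; both sides converge as the kernel shrinks.
  refine tendsto_nhds_unique hL (hR.congr fun k => ?_)
  rw [← hsplit (hpab.mollify hΩ hb hM _) (hpbb.mollify hΩ hb hM _)]
  refine (hpa.integral_minor_mollify hpb ha hb' hΩ hb hu hga hgb hφ hc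
    (fun x hx => hρ x hx (Metric.mem_closedBall_self hr.le)) _ fun x hx => ?_).symm
  exact (Metric.closedBall_subset_closedBall (hlt k).le).trans (hρ x hx)

end

/-! ### Weak* continuity of minors -/

section

variable {Ω : Set E3} {M : ℝ} {φ : E3 → ℝ}

/-- Testing weak* convergence with the kernel centred at x turns it into pointwise convergence. -/
theorem tendsto_mollify_of_weakStar {p : ℕ → E3 → ℝ} {α : ℝ}
    (hw : ∀ ψ : E3 → ℝ, IntegrableOn ψ Ω →
      Tendsto (fun n => ∫ x in Ω, ψ x * p n x) atTop (𝓝 ((∫ x in Ω, ψ x) * α)))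
    (ρ : ContDiffBump (0 : E3)) {x : E3} (hx : Metric.closedBall x ρ.rOut ⊆ Ω) :
    Tendsto (fun n => mollify ρ Ω (p n) x) atTop (𝓝 α) := by
  have := hw _ (integrable_normed_sub ρ x).integrableOn
  rw [setIntegral_normed_sub ρ hx, one_mul] at this
  simpa only [mollify, mul_comm] using this

/-- After mollifying one of the factors, weak* limits can be multiplied. -/
theorem tendsto_integral_mollify_mul {p g : ℕ → E3 → ℝ} {α β : ℝ}
    (hΩ : IsOpen Ω) (hb : Bornology.IsBounded Ω) (hM : 0 ≤ M)
    (hp : ∀ n, IsBddOn Ω M (p n)) (hg : ∀ n, IsBddOn Ω M (g n))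
    (hpw : ∀ ψ : E3 → ℝ, IntegrableOn ψ Ω →
      Tendsto (fun n => ∫ x in Ω, ψ x * p n x) atTop (𝓝 ((∫ x in Ω, ψ x) * α)))
    (hgw : ∀ ψ : E3 → ℝ, IntegrableOn ψ Ω →
      Tendsto (fun n => ∫ x in Ω, ψ x * g n x) atTop (𝓝 ((∫ x in Ω, ψ x) * β)))
    (hφ : IntegrableOn φ Ω) (ρ : ContDiffBump (0 : E3))
    (hρ : ∀ x ∈ tsupport φ, Metric.closedBall x ρ.rOut ⊆ Ω) :
    Tendsto (fun n => ∫ x in Ω, mollify ρ Ω (p n) x * (g n x * φ x)) atTop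
      (𝓝 ((∫ x in Ω, φ x) * (α * β))) := by
  have hbd := fun n => (hp n).mollify hΩ hb hM ρ
  have hdiff : ∀ n, IntegrableOn (fun x => (mollify ρ Ω (p n) x - α) * φ x) Ω := fun n => by
    simp only [sub_mul]
    exact ((hbd n).integrable_mul hφ).sub (hφ.const_mul α)
  -- The mollified factor times φ converges strongly in L¹ by dominated convergence, so the merely
  -- bounded `g n` cannot spoil the limit.
  have hzero : Tendsto (fun n => ∫ x in Ω, g n x * ((mollify ρ Ω (p n) x - α) * φ x)) atTop
      (𝓝 0) := by
    have hlim : Tendsto (fun n => M * ∫ x in Ω, |(mollify ρ Ω (p n) x - α) * φ x|) atTop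
        (𝓝 (M * ∫ _x in Ω, (0 : ℝ))) := by
      refine Tendsto.const_mul M ?_
      refine tendsto_integral_of_dominated_convergence (fun x => (M + |α|) * |φ x|)
        (fun n => (hdiff n).norm.aestronglyMeasurable) (hφ.norm.const_mul _)
        (fun n => ae_of_all _ fun x => ?_) (ae_of_all _ fun x => ?_)
      · rw [norm_abs_eq_norm, norm_mul]
        exact mul_le_mul_of_nonneg_right ((norm_sub_le _ _).trans
          (add_le_add (abs_mollify_le ρ (hp n) hM x) le_rfl)) (norm_nonneg _)
      · by_cases hx : x ∈ tsupport φ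
        · simpa using (((tendsto_mollify_of_weakStar hpw ρ (hρ x hx)).sub_const α).mul_const
            (φ x)).abs
        · simp [image_eq_zero_of_notMem_tsupport hx]
    rw [integral_zero, mul_zero] at hlim
    exact squeeze_zero_norm (fun n => (hg n).norm_integral_mul_le (hdiff n)) hlim
  have := hzero.add ((hgw φ hφ).mul_const α)
  rw [zero_add] at this
  refine (this.congr fun n => ?_).trans (by rw [mul_assoc, mul_comm α])
  rw [← integral_mul_const, ← integral_add ((hg n).integrable_mul (hdiff n))]
  · congr 1
    ext x
    ring
  · refine (((hg n).integrable_mul hφ).mul_const α).congr (ae_of_all _ fun x => ?_)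
    simp only
    ring

/-- Weak* continuity of the `2 × 2` minors of bounded weak gradients. -/
theorem HasWeakDeriv.tendsto_integral_minor {u v : ℕ → E3 → ℝ} {p g : ℕ → Fin 3 → E3 → ℝ}
    {α β : Fin 3 → ℝ} {x₀ : E3} {r : ℝ}
    (hp' : ∀ n j, HasWeakDeriv Ω (EuclideanSpace.single j 1) (u n) (p n j))
    (hg' : ∀ n j, HasWeakDeriv Ω (EuclideanSpace.single j 1) (v n) (g n j))
    (hΩ : IsOpen Ω) (hb : Bornology.IsBounded Ω) (hM : 0 ≤ M) (hu : ∀ n, IsBddOn Ω M (u n))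
    (hp : ∀ n j, IsBddOn Ω M (p n j)) (hg : ∀ n j, IsBddOn Ω M (g n j))
    (hpw : ∀ j, ∀ ψ : E3 → ℝ, IntegrableOn ψ Ω →
      Tendsto (fun n => ∫ x in Ω, ψ x * p n j x) atTop (𝓝 ((∫ x in Ω, ψ x) * α j)))
    (hgw : ∀ j, ∀ ψ : E3 → ℝ, IntegrableOn ψ Ω →
      Tendsto (fun n => ∫ x in Ω, ψ x * g n j x) atTop (𝓝 ((∫ x in Ω, ψ x) * β j)))
    (hr : 0 < r) (hB : Metric.closedBall x₀ (3 * r) ⊆ Ω)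
    (hφ : ContDiff ℝ ∞ φ) (hc : HasCompactSupport φ) (hs : tsupport φ ⊆ Metric.ball x₀ r)
    (i j : Fin 3) :
    Tendsto (fun n => ∫ x in Ω, φ x * (p n i x * g n j x - p n j x * g n i x)) atTop
      (𝓝 ((∫ x in Ω, φ x) * (α i * β j - α j * β i))) := by
  have hφi : IntegrableOn φ Ω := (hφ.continuous.integrable_of_hasCompactSupport hc).integrableOn
  have hdi : ∀ c, IntegrableOn (fun x => fderiv ℝ φ x c) Ω := fun c =>
    ((contDiff_fderiv_apply_const hφ c).continuous.integrable_of_hasCompactSupport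
      (hc.fderiv_apply ℝ c)).integrableOn
  have hball : ∀ x ∈ tsupport φ, ∀ δ, δ ≤ r → Metric.closedBall x δ ⊆ Ω := fun x hx δ hδ => by
    refine (Metric.closedBall_subset_closedBall' ?_).trans hB
    linarith [Metric.mem_ball.1 (hs hx)]
  have hsΩ : tsupport φ ⊆ Ω := fun x hx => hball x hx r le_rfl (Metric.mem_closedBall_self hr.le)
  set ei : E3 := EuclideanSpace.single i 1
  set ej : E3 := EuclideanSpace.single j 1
  set C : ℝ := 3 * M * (M * ∫ x in Ω, (|fderiv ℝ φ x ei| + |fderiv ℝ φ x ej|)) with hC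
  have hC0 : 0 ≤ C := by
    have : 0 ≤ ∫ x in Ω, (|fderiv ℝ φ x ei| + |fderiv ℝ φ x ej|) :=
      integral_nonneg fun x => by positivity
    positivity
  have hwint : ∀ n, IntegrableOn
      (fun x => fderiv ℝ φ x ei * g n j x - fderiv ℝ φ x ej * g n i x) Ω := fun n => by
    refine (((hg n j).integrable_mul (hdi ei)).sub ((hg n i).integrable_mul (hdi ej))).congr
      (ae_of_all _ fun x => ?_)
    simp only [Pi.sub_apply]
    ring
  -- After integration by parts, mollification enters only through u minus its mollification, which
  -- is uniformly small where φ lives. The error is thus O(kernel radius) uniformly in n, so no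
  -- compactness argument is needed.
  have hclose : ∀ (ρ : ContDiffBump (0 : E3)), ρ.rOut < r → ∀ n,
      |(∫ x in Ω, φ x * (p n i x * g n j x - p n j x * g n i x)) -
        ∫ x in Ω, φ x * (mollify ρ Ω (p n i) x * g n j x - mollify ρ Ω (p n j) x * g n i x)| ≤
      C * ρ.rOut := by
    intro ρ hρ n
    rw [(hp' n i).integral_minor (hp' n j) (hg' n i) (hg' n j) hΩ hb hM (hu n) (hp n i) (hp n j)
        (hg n i) (hg n j) hφ hc hr (fun x hx => hball x hx r le_rfl),
      (hp' n i).integral_minor_mollify (hp' n j) (hg' n i) (hg' n j) hΩ hb (hu n)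
        (hg n i) (hg n j) hφ hc hsΩ ρ (fun x hx => hball x hx _ hρ.le),
      ← neg_sub', abs_neg, ← integral_sub ((hu n).integrable_mul (hwint n))
        (((hu n).mollify hΩ hb hM ρ).integrable_mul (hwint n))]
    have hCe : C * ρ.rOut =
        ∫ x in Ω, 3 * M * ρ.rOut * (M * (|fderiv ℝ φ x ei| + |fderiv ℝ φ x ej|)) := by
      rw [integral_const_mul, integral_const_mul, hC]
      ring
    rw [hCe, ← Real.norm_eq_abs]
    refine norm_integral_le_of_norm_le
      ((((hdi ei).norm.add (hdi ej).norm).const_mul M).const_mul _) ?_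
    filter_upwards [HasWeakDeriv.ae_abs_mollify_sub_le (hp' n) hΩ hb (hu n) (hp n) hM hB hr ρ hρ,
      (hg n i).bound, (hg n j).bound] with x hx hgi hgj
    by_cases hxs : x ∈ tsupport φ
    · rw [← sub_mul, norm_mul]
      refine mul_le_mul (hx (hs hxs)) ?_ (norm_nonneg _)
        (mul_nonneg (by positivity) ρ.rOut_pos.le)
      refine (norm_sub_le _ _).trans ?_
      rw [norm_mul, norm_mul, mul_add, Real.norm_eq_abs, Real.norm_eq_abs, Real.norm_eq_abs,
        Real.norm_eq_abs, mul_comm, mul_comm |fderiv ℝ φ x ej|]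
      gcongr
    · have h0 : ∀ c, fderiv ℝ φ x c = 0 := fun c => image_eq_zero_of_notMem_tsupport
        (f := fun x => fderiv ℝ φ x c) fun h => hxs (tsupport_fderiv_apply_subset ℝ c h)
      simp [h0]
  rw [Metric.tendsto_atTop]
  intro ε hε
  obtain ⟨δ, hδ, hδr, hδε⟩ : ∃ δ : ℝ, 0 < δ ∧ δ < r ∧ C * δ < ε / 2 := by
    -- C may vanish, hence C + 1 in the denominator.
    refine ⟨min (r / 2) (ε / (4 * (C + 1))), by positivity,
      (min_le_left _ _).trans_lt (by linarith), ?_⟩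
    calc C * min (r / 2) (ε / (4 * (C + 1))) ≤ (C + 1) * (ε / (4 * (C + 1))) :=
          mul_le_mul (by linarith) (min_le_right _ _) (by positivity) (by positivity)
      _ = ε / 4 := by field_simp
      _ < ε / 2 := by linarith
  have hlim := (tendsto_integral_mollify_mul hΩ hb hM (fun n => hp n i) (fun n => hg n j)
      (hpw i) (hgw j) hφi (bumpOfRadius hδ) fun x hx => hball x hx _ hδr.le).sub
    (tendsto_integral_mollify_mul hΩ hb hM (fun n => hp n j) (fun n => hg n i)
      (hpw j) (hgw i) hφi (bumpOfRadius hδ) fun x hx => hball x hx _ hδr.le)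
  rw [← mul_sub] at hlim
  obtain ⟨N, hN⟩ := Metric.tendsto_atTop.1 hlim (ε / 2) (by linarith)
  refine ⟨N, fun n hn => ?_⟩
  have h1 := hN n hn
  have h2 := hclose (bumpOfRadius hδ) hδr n
  rw [← integral_sub
    (((hp n i).mollify hΩ hb hM _).integrable_mul ((hg n j).integrable_mul hφi))
    (((hp n j).mollify hΩ hb hM _).integrable_mul ((hg n i).integrable_mul hφi))] at h1
  have h3 : (fun x => φ x * (mollify (bumpOfRadius hδ) Ω (p n i) x * g n j x -
      mollify (bumpOfRadius hδ) Ω (p n j) x * g n i x)) =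
      fun x => mollify (bumpOfRadius hδ) Ω (p n i) x * (g n j x * φ x) -
        mollify (bumpOfRadius hδ) Ω (p n j) x * (g n i x * φ x) := by
    ext x
    ring
  rw [h3, ← Real.dist_eq] at h2
  have h4 : C * (bumpOfRadius hδ).rOut < ε / 2 := hδε
  linarith [dist_triangle (∫ x in Ω, φ x * (p n i x * g n j x - p n j x * g n i x))
    (∫ x in Ω, (mollify (bumpOfRadius hδ) Ω (p n i) x * (g n j x * φ x) -
        mollify (bumpOfRadius hδ) Ω (p n j) x * (g n i x * φ x)))
    ((∫ x in Ω, φ x) * (α i * β j - α j * β i))]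

end

/-! ### The minors relation -/

/-- The minors relation for `2 × 2` minors. -/
theorem IsHomogeneousGradientYoungMeasure.integral_minor {ν : Measure M33}
    (h : IsHomogeneousGradientYoungMeasure ν) (i k j l : Fin 3) :
    ∫ A, (A i j * A k l - A i l * A k j) ∂ν =
      barycentre ν i j * barycentre ν k l - barycentre ν i l * barycentre ν k j := by
  obtain ⟨-, Ω, hΩ, hb, ⟨x₀, hx₀⟩, y, G, hyG, hlim⟩ := h
  obtain ⟨M, hM⟩ := hyG.bounded
  obtain ⟨R, hR, hRΩ⟩ := Metric.nhds_basis_closedBall.mem_iff.1 (hΩ.mem_nhds hx₀)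
  have hent : ∀ i j : Fin 3, Continuous fun A : M33 => A i j := fun i j =>
    (continuous_apply j).comp (continuous_apply i)
  have hbdG : ∀ n i j, IsBddOn Ω |M| (fun x => G n x i j) := fun n i j =>
    ⟨(hent i j).comp_aestronglyMeasurable (hyG.aestronglyMeasurable_grad n), by
      filter_upwards [hM n] with x hx using (hx.2 i j).trans (le_abs_self M)⟩
  have hbdy : ∀ n i, IsBddOn Ω |M| (fun x => y n x i) := fun n i =>
    ⟨(EuclideanSpace.proj (𝕜 := ℝ) i).continuous.comp_aestronglyMeasurable
      (hyG.aestronglyMeasurable n), by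
      filter_upwards [hM n] with x hx
      exact ((PiLp.norm_apply_le (y n x) i).trans hx.1).trans (le_abs_self M)⟩
  have hwk : ∀ n i j, HasWeakDeriv Ω (EuclideanSpace.single j 1) (fun x => y n x i)
      (fun x => G n x i j) := fun n i j => hyG.hasWeakGradient n i j
  have hws : ∀ i j, ∀ ψ : E3 → ℝ, IntegrableOn ψ Ω →
      Tendsto (fun n => ∫ x in Ω, ψ x * G n x i j) atTop
        (𝓝 ((∫ x in Ω, ψ x) * barycentre ν i j)) := fun i j ψ hψ => hlim _ (hent i j) ψ hψ
  let φ : ContDiffBump x₀ := ⟨R / 12, R / 6, by linarith, by linarith⟩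
  have hφs : tsupport φ ⊆ Metric.ball x₀ (R / 3) := by
    rw [φ.tsupport_eq]
    exact Metric.closedBall_subset_ball (by simp only [φ]; linarith)
  have h1 := HasWeakDeriv.tendsto_integral_minor (φ := φ) (fun n => hwk n i) (fun n => hwk n k)
    hΩ hb (abs_nonneg M) (fun n => hbdy n i) (fun n => hbdG n i) (fun n => hbdG n k)
    (hws i) (hws k) (x₀ := x₀) (r := R / 3) (by linarith) (by convert hRΩ using 2; ring)
    φ.contDiff φ.hasCompactSupport hφs j l
  have h2 := hlim (fun A => A i j * A k l - A i l * A k j)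
    (((hent i j).mul (hent k l)).sub ((hent i l).mul (hent k j))) φ φ.integrable.integrableOn
  -- The same sequence has two limits: one from the Young measure, one from continuity of minors.
  -- They share the factor ∫ φ > 0.
  have h3 := tendsto_nhds_unique h2 h1
  have hpos : (∫ x in Ω, φ x) ≠ 0 := by
    rw [setIntegral_eq_integral_of_forall_compl_eq_zero]
    · exact φ.integral_pos.ne'
    · intro x hx
      by_contra hne
      have : x ∈ tsupport φ := subset_tsupport _ hne
      exact hx (hRΩ (Metric.ball_subset_closedBall
        (Metric.ball_subset_ball (by linarith) (hφs this))))
  exact mul_left_cancel₀ hpos h3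

/-! ### Cofactors and rotations -/

instance M33.secondCountableTopology : SecondCountableTopology M33 :=
  inferInstanceAs (SecondCountableTopology (Fin 3 → Fin 3 → ℝ))

/-- The entries of the cofactor matrix, written with cyclic indices. -/
def cofEntry (A : M33) (a b : Fin 3) : ℝ :=
  A (a + 1) (b + 1) * A (a + 2) (b + 2) - A (a + 1) (b + 2) * A (a + 2) (b + 1)

theorem continuous_entry (a b : Fin 3) : Continuous fun A : M33 => A a b :=
  (continuous_apply b).comp (continuous_apply a)

theorem continuous_cofEntry (a b : Fin 3) : Continuous fun A : M33 => cofEntry A a b :=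
  ((continuous_entry _ _).mul (continuous_entry _ _)).sub
    ((continuous_entry _ _).mul (continuous_entry _ _))

/-- RᵀR = 1 and det R = 1 force adj R = Rᵀ, so a rotation is its own cofactor matrix. -/
theorem cofEntry_of_mem_specialOrthogonalGroup {R : M33}
    (hR : R ∈ Matrix.specialOrthogonalGroup (Fin 3) ℝ) (a b : Fin 3) :
    cofEntry R a b = R a b := by
  rw [Matrix.mem_specialOrthogonalGroup_iff] at hR
  have h1 : R.transpose * R = 1 := (Matrix.mem_orthogonalGroup_iff' _ _).1 hR.1
  have h2 : R.adjugate = R.transpose := by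
    calc R.adjugate = R.transpose * R * R.adjugate := by rw [h1, one_mul]
      _ = R.transpose := by rw [mul_assoc, Matrix.mul_adjugate, hR.2, one_smul, mul_one]
  have h3 := congrFun (congrFun h2 b) a
  rw [Matrix.transpose_apply] at h3
  rw [← h3, Matrix.adjugate_fin_three]
  fin_cases a <;> fin_cases b <;> simp [cofEntry] <;> ring

theorem sum_sq_of_mem_specialOrthogonalGroup {R : M33}
    (hR : R ∈ Matrix.specialOrthogonalGroup (Fin 3) ℝ) (b : Fin 3) : ∑ a, R a b ^ 2 = 1 := by
  have h1 : R.transpose * R = 1 := (Matrix.mem_orthogonalGroup_iff' _ _).1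
    (Matrix.mem_specialOrthogonalGroup_iff.1 hR).1
  have h2 := congrFun (congrFun h1 b) b
  simpa [Matrix.mul_apply, sq] using h2

theorem abs_entry_le_one_of_mem_specialOrthogonalGroup {R : M33}
    (hR : R ∈ Matrix.specialOrthogonalGroup (Fin 3) ℝ) (a b : Fin 3) : |R a b| ≤ 1 := by
  rw [← sq_le_one_iff_abs_le_one, ← sum_sq_of_mem_specialOrthogonalGroup hR b]
  exact Finset.single_le_sum (f := fun a => R a b ^ 2) (fun _ _ => sq_nonneg _)
    (Finset.mem_univ a)

/-! ### Separating the wells by entries and cofactors -/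

section

variable {η₁ η₂ : ℝ}

theorem mul_tetragonalU_apply (R : M33) (i a b : Fin 3) :
    (R * tetragonalU η₁ η₂ i) a b = R a b * if b = i then η₂ else η₁ := by
  rw [tetragonalU, Matrix.mul_diagonal]

/-- Cofactors are multiplicative, and cof Uᵢ is diagonal with entry η₁² in place i and η₁η₂
elsewhere. -/
theorem cofEntry_mul_tetragonalU {R : M33} (hR : R ∈ Matrix.specialOrthogonalGroup (Fin 3) ℝ)
    (i a b : Fin 3) : cofEntry (R * tetragonalU η₁ η₂ i) a b =
      R a b * if b = i then η₁ ^ 2 else η₁ * η₂ := by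
  rw [← cofEntry_of_mem_specialOrthogonalGroup hR a b]
  simp only [cofEntry, mul_tetragonalU_apply]
  fin_cases b <;> fin_cases i <;> simp <;> ring

/-- On the well `SO(3) Uᵢ`, this function takes the value `R a b` at `R Uᵢ` if `b = i`, and
vanishes if `b ≠ i`. -/
noncomputable def wellEntry (η₁ η₂ : ℝ) (a b : Fin 3) (A : M33) : ℝ :=
  (η₂ * A a b - cofEntry A a b) / (η₂ ^ 2 - η₁ ^ 2)

/-- On the well `SO(3) Uᵢ`, this function takes the value `R a b` at `R Uᵢ` if `b ≠ i`, and
vanishes if `b = i`. -/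
noncomputable def offWellEntry (η₁ η₂ : ℝ) (a b : Fin 3) (A : M33) : ℝ :=
  (A a b - η₂ * wellEntry η₁ η₂ a b A) / η₁

theorem sq_sub_sq_ne_zero (hη₁ : 0 < η₁) (hη₂ : 0 < η₂) (hne : η₁ ≠ η₂) :
    η₂ ^ 2 - η₁ ^ 2 ≠ 0 := by
  rw [sq_sub_sq]
  exact mul_ne_zero (by positivity) (sub_ne_zero.2 hne.symm)

/-- The diagonal matrix η₂Uᵢ − cof Uᵢ has entries η₂η₁ − η₁η₂ = 0 off place i and η₂² − η₁² at place
i. -/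
theorem wellEntry_mul_tetragonalU (hη₁ : 0 < η₁) (hη₂ : 0 < η₂) (hne : η₁ ≠ η₂)
    {R : M33} (hR : R ∈ Matrix.specialOrthogonalGroup (Fin 3) ℝ) (i a b : Fin 3) :
    wellEntry η₁ η₂ a b (R * tetragonalU η₁ η₂ i) = if b = i then R a b else 0 := by
  have := sq_sub_sq_ne_zero hη₁ hη₂ hne
  rw [wellEntry, cofEntry_mul_tetragonalU hR, mul_tetragonalU_apply, div_eq_iff this]
  split_ifs <;> ring

theorem offWellEntry_mul_tetragonalU (hη₁ : 0 < η₁) (hη₂ : 0 < η₂) (hne : η₁ ≠ η₂)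
    {R : M33} (hR : R ∈ Matrix.specialOrthogonalGroup (Fin 3) ℝ) (i a b : Fin 3) :
    offWellEntry η₁ η₂ a b (R * tetragonalU η₁ η₂ i) = if b = i then 0 else R a b := by
  rw [offWellEntry, wellEntry_mul_tetragonalU hη₁ hη₂ hne hR, mul_tetragonalU_apply,
    div_eq_iff hη₁.ne']
  split_ifs <;> ring

/-- At a common point `wellEntry` would make the j-th column of a rotation vanish, but that column
is a unit vector. -/
theorem tetragonalWell_disjoint (hη₁ : 0 < η₁) (hη₂ : 0 < η₂) (hne : η₁ ≠ η₂) {j k : Fin 3}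
    (hjk : j ≠ k) : Disjoint (tetragonalWell η₁ η₂ j) (tetragonalWell η₁ η₂ k) := by
  rw [Set.disjoint_left]
  rintro _ ⟨R, hR, rfl⟩ ⟨S, hS, h⟩
  have h0 : ∀ a, R a j = 0 := fun a => by
    have := wellEntry_mul_tetragonalU hη₁ hη₂ hne hR j a j
    rw [h, wellEntry_mul_tetragonalU hη₁ hη₂ hne hS, if_neg hjk, if_pos rfl] at this
    exact this.symm
  simpa [h0] using sum_sq_of_mem_specialOrthogonalGroup hR j

variable {ν : Measure M33}

theorem ae_mem_tetragonalWell (hsupp : ν.support ⊆ tetragonalK η₁ η₂) :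
    ∀ᵐ A ∂ν, ∃ i, ∃ R ∈ Matrix.specialOrthogonalGroup (Fin 3) ℝ, A = R * tetragonalU η₁ η₂ i := by
  filter_upwards [Measure.support_mem_ae (μ := ν)] with A hA
  simpa [tetragonalK, tetragonalWell] using hsupp hA

theorem integrable_entry [IsFiniteMeasure ν] (hη₁ : 0 < η₁) (hη₂ : 0 < η₂)
    (hsupp : ν.support ⊆ tetragonalK η₁ η₂) (a b : Fin 3) : Integrable (fun A => A a b) ν := by
  refine Integrable.of_bound (continuous_entry a b).aestronglyMeasurable (η₁ + η₂) ?_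
  filter_upwards [ae_mem_tetragonalWell hsupp] with A ⟨i, R, hR, hA⟩
  rw [hA, mul_tetragonalU_apply, norm_mul]
  refine (mul_le_of_le_one_left (norm_nonneg _)
    (abs_entry_le_one_of_mem_specialOrthogonalGroup hR a b)).trans ?_
  split_ifs <;> rw [Real.norm_of_nonneg (by positivity)] <;> linarith

theorem integrable_cofEntry [IsFiniteMeasure ν] (hη₁ : 0 < η₁) (hη₂ : 0 < η₂)
    (hsupp : ν.support ⊆ tetragonalK η₁ η₂) (a b : Fin 3) :
    Integrable (fun A => cofEntry A a b) ν := by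
  refine Integrable.of_bound (continuous_cofEntry a b).aestronglyMeasurable
    (η₁ ^ 2 + η₁ * η₂) ?_
  filter_upwards [ae_mem_tetragonalWell hsupp] with A ⟨i, R, hR, hA⟩
  rw [hA, cofEntry_mul_tetragonalU hR, norm_mul]
  refine (mul_le_of_le_one_left (norm_nonneg _)
    (abs_entry_le_one_of_mem_specialOrthogonalGroup hR a b)).trans ?_
  have := mul_pos hη₁ hη₂
  split_ifs <;> rw [Real.norm_of_nonneg (by positivity)] <;> nlinarith

theorem integrable_wellEntry [IsFiniteMeasure ν] (hη₁ : 0 < η₁) (hη₂ : 0 < η₂)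
    (hsupp : ν.support ⊆ tetragonalK η₁ η₂) (a b : Fin 3) :
    Integrable (wellEntry η₁ η₂ a b) ν :=
  (((integrable_entry hη₁ hη₂ hsupp a b).const_mul η₂).sub
    (integrable_cofEntry hη₁ hη₂ hsupp a b)).div_const _

theorem integrable_offWellEntry [IsFiniteMeasure ν] (hη₁ : 0 < η₁) (hη₂ : 0 < η₂)
    (hsupp : ν.support ⊆ tetragonalK η₁ η₂) (a b : Fin 3) :
    Integrable (offWellEntry η₁ η₂ a b) ν :=
  ((integrable_entry hη₁ hη₂ hsupp a b).sub
    ((integrable_wellEntry hη₁ hη₂ hsupp a b).const_mul η₂)).div_const _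

/-! ### Averages over the wells and the volume-fraction inequality -/

theorem IsHomogeneousGradientYoungMeasure.integral_cofEntry
    (hν : IsHomogeneousGradientYoungMeasure ν) {d : ℝ} (hbar : barycentre ν = d • (1 : M33))
    (a b : Fin 3) : ∫ A, cofEntry A a b ∂ν = if a = b then d ^ 2 else 0 := by
  simp only [cofEntry]
  rw [hν.integral_minor, hbar]
  fin_cases a <;> fin_cases b <;> simp <;> ring

theorem IsHomogeneousGradientYoungMeasure.integral_wellEntry
    (hν : IsHomogeneousGradientYoungMeasure ν) (hη₁ : 0 < η₁) (hη₂ : 0 < η₂)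
    (hsupp : ν.support ⊆ tetragonalK η₁ η₂) {d : ℝ} (hbar : barycentre ν = d • (1 : M33))
    (a b : Fin 3) : ∫ A, wellEntry η₁ η₂ a b A ∂ν =
      if a = b then (η₂ * d - d ^ 2) / (η₂ ^ 2 - η₁ ^ 2) else 0 := by
  have := hν.1
  have h1 : ∫ A, A a b ∂ν = if a = b then d else 0 := by
    have := congrFun (congrFun hbar a) b
    simpa [barycentre, Matrix.one_apply] using this
  simp only [wellEntry]
  rw [integral_div, integral_sub ((integrable_entry hη₁ hη₂ hsupp a b).const_mul η₂)
    (integrable_cofEntry hη₁ hη₂ hsupp a b), integral_const_mul, h1,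
    hν.integral_cofEntry hbar]
  split_ifs <;> simp

theorem IsHomogeneousGradientYoungMeasure.integral_offWellEntry_self
    (hν : IsHomogeneousGradientYoungMeasure ν) (hη₁ : 0 < η₁) (hη₂ : 0 < η₂)
    (hsupp : ν.support ⊆ tetragonalK η₁ η₂) {d : ℝ} (hbar : barycentre ν = d • (1 : M33))
    (i : Fin 3) : ∫ A, offWellEntry η₁ η₂ i i A ∂ν =
      (d - η₂ * ((η₂ * d - d ^ 2) / (η₂ ^ 2 - η₁ ^ 2))) / η₁ := by
  have := hν.1
  have h1 : ∫ A, A i i ∂ν = d := by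
    have := congrFun (congrFun hbar i) i
    simpa [barycentre, Matrix.one_apply] using this
  simp only [offWellEntry]
  rw [integral_div, integral_sub (integrable_entry hη₁ hη₂ hsupp i i)
    ((integrable_wellEntry hη₁ hη₂ hsupp i i).const_mul η₂), integral_const_mul, h1,
    hν.integral_wellEntry hη₁ hη₂ hsupp hbar, if_pos rfl]

theorem well_fraction_inequalities {d : ℝ} (hη₁ : 0 < η₁) (hη₂ : 0 < η₂) (hne : η₁ ≠ η₂)
    (hd : 0 < d) (hd3 : d ^ 3 = η₁ ^ 2 * η₂) :
    0 < (η₂ * d - d ^ 2) / (η₂ ^ 2 - η₁ ^ 2) ∧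
      2 * ((η₂ * d - d ^ 2) / (η₂ ^ 2 - η₁ ^ 2)) <
        (d - η₂ * ((η₂ * d - d ^ 2) / (η₂ ^ 2 - η₁ ^ 2))) / η₁ := by
  -- With m = d/η₁, the relation d³ = η₁²η₂ says η₂ = m³η₁, and everything becomes rational in m.
  obtain ⟨m, hm, rfl⟩ : ∃ m, 0 < m ∧ d = m * η₁ := ⟨d / η₁, by positivity, by field_simp⟩
  obtain rfl : η₂ = m ^ 3 * η₁ := by
    have : η₁ ^ 2 * η₂ = η₁ ^ 2 * (m ^ 3 * η₁) := by rw [← hd3]; ring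
    exact mul_left_cancel₀ (by positivity) this
  have hm1 : m ≠ 1 := by
    rintro rfl
    simp at hne
  have hD : 0 < m ^ 4 + m ^ 2 + 1 := by positivity
  have hβ : (m ^ 3 * η₁ * (m * η₁) - (m * η₁) ^ 2) / ((m ^ 3 * η₁) ^ 2 - η₁ ^ 2) =
      m ^ 2 / (m ^ 4 + m ^ 2 + 1) := by
    rw [div_eq_div_iff (sq_sub_sq_ne_zero hη₁ hη₂ hne) hD.ne']
    ring
  rw [hβ]
  have hξ : (m * η₁ - m ^ 3 * η₁ * (m ^ 2 / (m ^ 4 + m ^ 2 + 1))) / η₁ =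
      (m + m ^ 3) / (m ^ 4 + m ^ 2 + 1) := by
    field_simp
    ring
  rw [hξ]
  refine ⟨by positivity, ?_⟩
  rw [← mul_div_assoc]
  refine div_lt_div_of_pos_right ?_ hD
  -- The numerators differ by m + m³ − 2m² = m(m − 1)².
  have : 0 < m * (m - 1) ^ 2 := mul_pos hm (by have := sub_ne_zero.2 hm1; positivity)
  nlinarith

/-! ### Counting support matrices -/

theorem integral_eq_of_ae_eq_zero_off_singleton {f : M33 → ℝ} {P : M33}
    (h : ∀ᵐ A ∂ν, A ≠ P → f A = 0) : ∫ A, f A ∂ν = ν.real {P} * f P := by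
  have : f =ᵐ[ν] Set.indicator {P} (fun _ => f P) := by
    filter_upwards [h] with A hA
    by_cases hAP : A = P
    · simp [hAP]
    · simp [hAP, hA hAP]
  rw [integral_congr_ae this, integral_indicator_const _ (measurableSet_singleton P), smul_eq_mul]

/-- The diagonal `wellEntry` j j has positive mean and vanishes on the other two wells. -/
theorem IsHomogeneousGradientYoungMeasure.support_inter_tetragonalWell_nonempty
    (hν : IsHomogeneousGradientYoungMeasure ν) (hη₁ : 0 < η₁) (hη₂ : 0 < η₂) (hne : η₁ ≠ η₂)
    (hsupp : ν.support ⊆ tetragonalK η₁ η₂) {d : ℝ} (hd : 0 < d) (hd3 : d ^ 3 = η₁ ^ 2 * η₂)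
    (hbar : barycentre ν = d • (1 : M33)) (j : Fin 3) :
    (ν.support ∩ tetragonalWell η₁ η₂ j).Nonempty := by
  by_contra! hempty
  have h1 := hν.integral_wellEntry hη₁ hη₂ hsupp hbar j j
  rw [if_pos rfl, integral_eq_zero_of_ae] at h1
  · exact (well_fraction_inequalities hη₁ hη₂ hne hd hd3).1.ne h1
  · filter_upwards [ae_mem_tetragonalWell hsupp, Measure.support_mem_ae (μ := ν)]
      with A ⟨i, R, hR, hA⟩ hAs
    have hij : j ≠ i := by
      rintro rfl
      exact Set.eq_empty_iff_forall_notMem.1 hempty A ⟨hAs, R, hR, hA⟩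
    rw [hA, wellEntry_mul_tetragonalU hη₁ hη₂ hne hR, if_neg hij, Pi.zero_apply]

/-- If a well contains a single matrix `R Uⱼ` of the support, then `R` fixes `eⱼ`. -/
theorem IsHomogeneousGradientYoungMeasure.entry_eq_one_of_single
    (hν : IsHomogeneousGradientYoungMeasure ν) (hη₁ : 0 < η₁) (hη₂ : 0 < η₂) (hne : η₁ ≠ η₂)
    (hsupp : ν.support ⊆ tetragonalK η₁ η₂) {d : ℝ} (hd : 0 < d) (hd3 : d ^ 3 = η₁ ^ 2 * η₂)
    (hbar : barycentre ν = d • (1 : M33)) {j : Fin 3} {R : M33}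
    (hR : R ∈ Matrix.specialOrthogonalGroup (Fin 3) ℝ)
    (h : ∀ A ∈ ν.support ∩ tetragonalWell η₁ η₂ j, A = R * tetragonalU η₁ η₂ j) :
    R j j = 1 := by
  have hβ := (well_fraction_inequalities hη₁ hη₂ hne hd hd3).1
  -- As vectors: the mass of the single matrix times R eⱼ equals β eⱼ. So R eⱼ is a unit vector and
  -- a positive multiple of eⱼ.
  have key : ∀ a, ν.real {R * tetragonalU η₁ η₂ j} * R a j =
      if a = j then (η₂ * d - d ^ 2) / (η₂ ^ 2 - η₁ ^ 2) else 0 := by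
    intro a
    rw [← hν.integral_wellEntry hη₁ hη₂ hsupp hbar a j,
      integral_eq_of_ae_eq_zero_off_singleton (P := R * tetragonalU η₁ η₂ j),
      wellEntry_mul_tetragonalU hη₁ hη₂ hne hR, if_pos rfl]
    filter_upwards [ae_mem_tetragonalWell hsupp, Measure.support_mem_ae (μ := ν)]
      with A ⟨i, S, hS, hA⟩ hAs hAP
    have hij : j ≠ i := by
      rintro rfl
      exact hAP (h A ⟨hAs, S, hS, hA⟩)
    rw [hA, wellEntry_mul_tetragonalU hη₁ hη₂ hne hS, if_neg hij]
  have hjj := key j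
  rw [if_pos rfl] at hjj
  rw [← hjj] at hβ
  have hpos : 0 < R j j := pos_of_mul_pos_right hβ measureReal_nonneg
  have hμ : ν.real {R * tetragonalU η₁ η₂ j} ≠ 0 := left_ne_zero_of_mul hβ.ne'
  have h0 : ∀ a, a ≠ j → R a j = 0 := fun a ha => by
    have := key a
    rw [if_neg ha] at this
    exact (mul_eq_zero.1 this).resolve_left hμ
  have hs := sum_sq_of_mem_specialOrthogonalGroup hR j
  rw [Finset.sum_eq_single j (fun a _ ha => by simp [h0 a ha]) (by simp)] at hs
  exact (pow_eq_one_iff_of_nonneg hpos.le two_ne_zero).1 hs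

theorem IsHomogeneousGradientYoungMeasure.two_lt_encard_support_inter
    (hν : IsHomogeneousGradientYoungMeasure ν) (hη₁ : 0 < η₁) (hη₂ : 0 < η₂) (hne : η₁ ≠ η₂)
    (hsupp : ν.support ⊆ tetragonalK η₁ η₂) {d : ℝ} (hd : 0 < d) (hd3 : d ^ 3 = η₁ ^ 2 * η₂)
    (hbar : barycentre ν = d • (1 : M33)) {j k : Fin 3} (hjk : j ≠ k) :
    2 < (ν.support ∩ (tetragonalWell η₁ η₂ j ∪ tetragonalWell η₁ η₂ k)).encard := by
  have := hν.1
  by_contra! hcard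
  obtain ⟨P, hPs, hPj⟩ :=
    hν.support_inter_tetragonalWell_nonempty hη₁ hη₂ hne hsupp hd hd3 hbar j
  obtain ⟨Q, hQs, hQk⟩ :=
    hν.support_inter_tetragonalWell_nonempty hη₁ hη₂ hne hsupp hd hd3 hbar k
  have hdis := tetragonalWell_disjoint hη₁ hη₂ hne hjk
  have hPQ : P ≠ Q := fun h => Set.disjoint_left.1 hdis hPj (h ▸ hQk)
  have hset : ({P, Q} : Set M33) =
      ν.support ∩ (tetragonalWell η₁ η₂ j ∪ tetragonalWell η₁ η₂ k) := by
    refine (Set.toFinite _).eq_of_subset_of_encard_le ?_ ?_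
    · rintro A (rfl | rfl)
      · exact ⟨hPs, Or.inl hPj⟩
      · exact ⟨hQs, Or.inr hQk⟩
    · rwa [Set.encard_pair hPQ]
  have hPuniq : ∀ A ∈ ν.support ∩ tetragonalWell η₁ η₂ j, A = P := by
    rintro A ⟨hAs, hAj⟩
    have : A ∈ ({P, Q} : Set M33) := hset ▸ ⟨hAs, Or.inl hAj⟩
    refine this.resolve_right fun h => Set.disjoint_left.1 hdis hAj ?_
    rw [Set.mem_singleton_iff.1 h]
    exact hQk
  have hQuniq : ∀ A ∈ ν.support ∩ tetragonalWell η₁ η₂ k, A = Q := by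
    rintro A ⟨hAs, hAk⟩
    have : A ∈ ({P, Q} : Set M33) := hset ▸ ⟨hAs, Or.inr hAk⟩
    refine this.resolve_left fun h => Set.disjoint_left.1 hdis hPj ?_
    rw [← h]
    exact hAk
  obtain ⟨R, hR, rfl⟩ := hPj
  obtain ⟨S, hS, rfl⟩ := hQk
  have hRj := hν.entry_eq_one_of_single hη₁ hη₂ hne hsupp hd hd3 hbar hR hPuniq
  have hSk := hν.entry_eq_one_of_single hη₁ hη₂ hne hsupp hd hd3 hbar hS hQuniq
  obtain ⟨i, hij, hik, hall⟩ : ∃ i : Fin 3, i ≠ j ∧ i ≠ k ∧ ∀ l, l = i ∨ l = j ∨ l = k := by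
    have : ∀ j k : Fin 3, j ≠ k → ∃ i : Fin 3, i ≠ j ∧ i ≠ k ∧ ∀ l, l = i ∨ l = j ∨ l = k := by
      decide
    exact this j k hjk
  -- Pointwise a.e.: both sides vanish on well i; on wells j and k the right side is 1 and the left
  -- is a diagonal rotation entry. Integrated, this reads ξ ≤ 2β.
  have hle : ∫ A, offWellEntry η₁ η₂ i i A ∂ν ≤
      ∫ A, (wellEntry η₁ η₂ j j A + wellEntry η₁ η₂ k k A) ∂ν := by
    refine integral_mono_ae (integrable_offWellEntry hη₁ hη₂ hsupp i i)
      ((integrable_wellEntry hη₁ hη₂ hsupp j j).add (integrable_wellEntry hη₁ hη₂ hsupp k k)) ?_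
    filter_upwards [ae_mem_tetragonalWell hsupp, Measure.support_mem_ae (μ := ν)]
      with A ⟨l, T, hT, hA⟩ hAs
    rcases hall l with rfl | rfl | rfl
    · rw [hA, offWellEntry_mul_tetragonalU hη₁ hη₂ hne hT,
        wellEntry_mul_tetragonalU hη₁ hη₂ hne hT, wellEntry_mul_tetragonalU hη₁ hη₂ hne hT,
        if_pos rfl, if_neg hij.symm, if_neg hik.symm, add_zero]
    · rw [hPuniq A ⟨hAs, T, hT, hA⟩, offWellEntry_mul_tetragonalU hη₁ hη₂ hne hR,
        wellEntry_mul_tetragonalU hη₁ hη₂ hne hR, wellEntry_mul_tetragonalU hη₁ hη₂ hne hR,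
        if_neg hij, if_pos rfl, if_neg hjk.symm, hRj, add_zero]
      exact (le_abs_self _).trans (abs_entry_le_one_of_mem_specialOrthogonalGroup hR i i)
    · rw [hQuniq A ⟨hAs, T, hT, hA⟩, offWellEntry_mul_tetragonalU hη₁ hη₂ hne hS,
        wellEntry_mul_tetragonalU hη₁ hη₂ hne hS, wellEntry_mul_tetragonalU hη₁ hη₂ hne hS,
        if_neg hik, if_pos rfl, if_neg hjk, hSk, zero_add]
      exact (le_abs_self _).trans (abs_entry_le_one_of_mem_specialOrthogonalGroup hS i i)
  rw [integral_add (integrable_wellEntry hη₁ hη₂ hsupp j j)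
      (integrable_wellEntry hη₁ hη₂ hsupp k k),
    hν.integral_offWellEntry_self hη₁ hη₂ hsupp hbar, hν.integral_wellEntry hη₁ hη₂ hsupp hbar,
    hν.integral_wellEntry hη₁ hη₂ hsupp hbar, if_pos rfl, if_pos rfl] at hle
  linarith [(well_fraction_inequalities hη₁ hη₂ hne hd hd3).2]

theorem IsHomogeneousGradientYoungMeasure.four_lt_encard_support
    (hν : IsHomogeneousGradientYoungMeasure ν) (hη₁ : 0 < η₁) (hη₂ : 0 < η₂) (hne : η₁ ≠ η₂)
    (hsupp : ν.support ⊆ tetragonalK η₁ η₂) {d : ℝ} (hd : 0 < d) (hd3 : d ^ 3 = η₁ ^ 2 * η₂)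
    (hbar : barycentre ν = d • (1 : M33)) : 4 < ν.support.encard := by
  by_contra! hcard
  have hfin : ν.support.Finite := Set.finite_of_encard_le_coe hcard
  set n : Fin 3 → ℕ := fun i => (ν.support ∩ tetragonalWell η₁ η₂ i).ncard with hn
  have hpair : ∀ j k : Fin 3, j ≠ k → 3 ≤ n j + n k := by
    intro j k hjk
    have h2 := hν.two_lt_encard_support_inter hη₁ hη₂ hne hsupp hd hd3 hbar hjk
    rw [← (hfin.inter_of_left _).cast_ncard_eq, Set.inter_union_distrib_left] at h2
    have h3 : 2 < ((ν.support ∩ tetragonalWell η₁ η₂ j) ∪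
      (ν.support ∩ tetragonalWell η₁ η₂ k)).ncard := by exact_mod_cast h2
    exact (Nat.succ_le_of_lt h3).trans (Set.ncard_union_le _ _)
  have hd' : ∀ j k : Fin 3, j ≠ k → Disjoint (ν.support ∩ tetragonalWell η₁ η₂ j)
      (ν.support ∩ tetragonalWell η₁ η₂ k) := fun j k hjk =>
    (tetragonalWell_disjoint hη₁ hη₂ hne hjk).mono Set.inter_subset_right Set.inter_subset_right
  have hsum : n 0 + n 1 + n 2 ≤ ν.support.ncard := by
    rw [hn, ← Set.ncard_union_eq (hd' 0 1 (by decide)) (hfin.inter_of_left _)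
      (hfin.inter_of_left _), ← Set.ncard_union_eq
      (Set.disjoint_union_left.2 ⟨hd' 0 2 (by decide), hd' 1 2 (by decide)⟩)
      ((hfin.inter_of_left _).union (hfin.inter_of_left _)) (hfin.inter_of_left _)]
    exact Set.ncard_le_ncard (by simp) hfin
  have h4 : ν.support.ncard ≤ 4 := by
    rw [← hfin.cast_ncard_eq] at hcard
    exact_mod_cast hcard
  have h01 := hpair 0 1 (by decide)
  have h02 := hpair 0 2 (by decide)
  have h12 := hpair 1 2 (by decide)
  -- Adding the three pair bounds gives 2(n 0 + n 1 + n 2) ≥ 9, so the integer sum is at least 5.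
  omega

end

theorem IsDoubleLaminate.encard_support_le {ν : Measure M33} (h : IsDoubleLaminate ν) :
    ν.support.encard ≤ 4 := by
  obtain ⟨A, B, C, D, r, s, t, -, -, -, -, -, -, rfl⟩ := h
  refine (Set.encard_le_encard (t := ({A, B, C, D} : Set M33)) ?_).trans ?_
  · refine Measure.support_subset_of_isClosed (Set.toFinite _).isClosed ?_
    rw [mem_ae_iff]
    have hm : MeasurableSet ({A, B, C, D} : Set M33)ᶜ := (Set.toFinite _).measurableSet.compl
    simp [Measure.dirac_apply' _ hm]
  · refine (Set.encard_insert_le _ _).trans ?_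
    have h3 : ({B, C, D} : Set M33).encard ≤ 3 := by
      refine (Set.encard_insert_le _ _).trans ?_
      have : ({C, D} : Set M33).encard ≤ 2 := by
        rcases eq_or_ne C D with rfl | h
        · simp
        · rw [Set.encard_pair h]
      calc _ ≤ (2 : ℕ∞) + 1 := by gcongr
        _ = 3 := by norm_num
    calc _ ≤ (3 : ℕ∞) + 1 := by gcongr
      _ = 4 := by norm_num

theorem theorem4 (η₁ η₂ : ℝ) (hη₁ : 0 < η₁) (hη₂ : 0 < η₂) (hne : η₁ ≠ η₂) :
    (¬ ∃ ν : Measure M33, IsHomogeneousGradientYoungMeasure ν ∧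
      ν.support ⊆ tetragonalK η₁ η₂ ∧
      barycentre ν = (η₁ ^ (2 / 3 : ℝ) * η₂ ^ (1 / 3 : ℝ)) • (1 : M33) ∧
      ∃ j k : Fin 3, j ≠ k ∧
        (ν.support ∩ (tetragonalWell η₁ η₂ j ∪ tetragonalWell η₁ η₂ k)).encard ≤ 2) ∧
    (∀ ν : Measure M33, IsHomogeneousGradientYoungMeasure ν →
      ν.support ⊆ tetragonalK η₁ η₂ →
      barycentre ν = (η₁ ^ (2 / 3 : ℝ) * η₂ ^ (1 / 3 : ℝ)) • (1 : M33) →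
      4 < ν.support.encard ∧ ¬ IsDoubleLaminate ν) := by
  have hd : 0 < η₁ ^ (2 / 3 : ℝ) * η₂ ^ (1 / 3 : ℝ) := by positivity
  have hd3 : (η₁ ^ (2 / 3 : ℝ) * η₂ ^ (1 / 3 : ℝ)) ^ 3 = η₁ ^ 2 * η₂ := by
    rw [mul_pow, ← Real.rpow_natCast, ← Real.rpow_natCast (η₂ ^ (1 / 3 : ℝ)),
      ← Real.rpow_mul hη₁.le, ← Real.rpow_mul hη₂.le, ← Real.rpow_natCast η₁ 2]
    norm_num
  refine ⟨?_, fun ν hν hsupp hbar => ?_⟩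
  · rintro ⟨ν, hν, hsupp, hbar, j, k, hjk, hcard⟩
    exact (hν.two_lt_encard_support_inter hη₁ hη₂ hne hsupp hd hd3 hbar hjk).not_ge hcard
  · have h4 := hν.four_lt_encard_support hη₁ hη₂ hne hsupp hd hd3 hbar
    exact ⟨h4, fun h => h4.not_ge h.encard_support_le⟩
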